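/- For coprime positive integers $a, b$ with $\frac ab > 1$, an $\frac ab$-power is a word $v^{\lfloor a/b\rfloor} v_0 v_1\cdots v_{r-1}$, where $v = v_0 \cdots v_{l-1}$ is a nonempty word whose length $l$ is divisible by $b$ and $r = l\,(\frac ab - \lfloor \frac ab\rfloor)$. Let $\mathbf{w}_{a/b}$ be the lexicographically least infinite word on the alphabet $\mathbb{Z}_{\ge 0}$ none of whose factors is an $\frac ab$-power. For $k \ge 2$, an integer sequence $s(i)_{i\ge 0}$ is $k$-regular if the $\mathbb{Z}$-module generated by the sequences $s(k^e i + j)_{i \ge 0}$ with $e \ge 0$ and $0 \le j \le k^e - 1$ is finitely generated. For integers $k, l \ge 2$ write $k \sim l$ if $k^s = l^t$ for some positive integers $s, t$. We write $\rho(\frac ab) = k$ if the set of integers $l \ge 2$ such that the sequence of letters of $\mathbf{w}_{a/b}$ is $l$-regular is exactly the equivalence class of $k$ under $\sim$. **Theorem.** Let $a, b$ be relatively prime positive integers such that $\frac32 < \frac ab < \frac53$ and $\gcd(b,5) = 1$. Let $\varphi$ be the $(5a-4b)$-uniform morphism on $\mathbb{Z}_{\ge 0}$ defined by $$\varphi(n)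 = 0^{a-1}\, 1\, 0^{a-b-1}\, 1\, 0^{2a-2b-1}\, 1\, 0^{a-b-1}\, (n+1),$$ and let $\varphi^\infty(0)$ be the infinite word having all the iterates $\varphi^m(0)$ as prefixes. Then $\mathbf{w}_{a/b} = \varphi^\infty(0)$. In particular, $\rho(\frac ab) = 5a - 4b$. -/

import Mathlib

namespace FracPow

/-! Words on the alphabet of non-negative integers: finite words are lists of natural numbers,
infinite words are functions `ℕ → ℕ`, with positions starting at `0`. -/

/-- The fractional power `v^{a/b} = v^⌊a/b⌋ v₀ v₁ ⋯ v_{l·frac(a/b) - 1}` of a word `v` of length `l`.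
Here `l · frac(a/b) = l * (a % b) / b`, and the division is exact when `b ∣ l`. -/
def fracPow (v : List ℕ) (a b : ℕ) : List ℕ :=
  (List.replicate (a / b) v).flatten ++ v.take (v.length * (a % b) / b)

/-- `u` is an `a/b`-power: `u = v^{a/b}` for a nonempty word `v` whose length is divisible by `b`. -/
def IsFracPow (a b : ℕ) (u : List ℕ) : Prop :=
  ∃ v : List ℕ, v ≠ [] ∧ b ∣ v.length ∧ u = fracPow v a b

/-- The factor of length `n` of the infinite word `x` starting at position `i`. -/
def factor (x : ℕ → ℕ) (i n : ℕ) : List ℕ :=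
  (List.range n).map fun j => x (i + j)

/-- The infinite word `x` is `a/b`-power-free: none of its factors is an `a/b`-power. -/
def PowerFree (a b : ℕ) (x : ℕ → ℕ) : Prop :=
  ∀ i n : ℕ, ¬ IsFracPow a b (factor x i n)

/-- `x` is the lexicographically least infinite `a/b`-power-free word `w_{a/b}`. The lexicographic
order is a linear order, so there is at most one such `x`. -/
def IsLexLeastPowerFree (a b : ℕ) (x : ℕ → ℕ) : Prop :=
  IsLeast {y : Lex (ℕ → ℕ) | PowerFree a b (ofLex y)} (toLex x)

/-- A morphism `φ` is `k`-uniform if every `φ n` has length `k`. -/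
def IsUniform (φ : ℕ → List ℕ) (k : ℕ) : Prop :=
  ∀ n : ℕ, (φ n).length = k

/-- The `n`-th iterate `φⁿ(c)`, where `φ` acts on finite words by concatenation. -/
def iter (φ : ℕ → List ℕ) (c n : ℕ) : List ℕ :=
  (fun u : List ℕ => u.flatMap φ)^[n] [c]

/-- The infinite word `φ^∞(c)`, for a morphism `φ` such that no `φ n` is empty and `φ c` starts
with `c` and has at least two letters. Its letter at position `i` is that of `φⁱ(c)`; this word
has length greater than `i`, and all the words `φⁿ(c)` are prefixes of the infinite word, as
`length_iter` and `iterInf_eq` show. -/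
def iterInf (φ : ℕ → List ℕ) (c : ℕ) : ℕ → ℕ :=
  fun i => (iter φ c i).getD i 0

theorem iter_succ (φ : ℕ → List ℕ) (c n : ℕ) :
    iter φ c (n + 1) = (iter φ c n).flatMap φ := by
  simp only [iter, Function.iterate_succ_apply']

theorem iter_prefix_succ (φ : ℕ → List ℕ) (c : ℕ) (t : List ℕ) (hc : φ c = c :: t) (n : ℕ) :
    iter φ c n <+: iter φ c (n + 1) := by
  induction n with
  | zero => exact ⟨t, by simp [iter, hc]⟩
  | succ n ih =>
    obtain ⟨s, hs⟩ := ih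
    refine ⟨s.flatMap φ, ?_⟩
    rw [iter_succ φ c (n + 1), ← hs, List.flatMap_append, ← iter_succ, hs]

theorem iter_prefix (φ : ℕ → List ℕ) (c : ℕ) (t : List ℕ) (hc : φ c = c :: t) {m n : ℕ}
    (h : m ≤ n) : iter φ c m <+: iter φ c n := by
  induction n, h using Nat.le_induction with
  | base => exact List.prefix_refl _
  | succ n _ ih => exact ih.trans (iter_prefix_succ φ c t hc n)

theorem length_le_flatMap (φ : ℕ → List ℕ) (h0 : ∀ n, φ n ≠ []) (u : List ℕ) :
    u.length ≤ (u.flatMap φ).length := by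
  induction u with
  | nil => simp
  | cons x u ih =>
    have := List.length_pos_iff.mpr (h0 x)
    simp only [List.flatMap_cons, List.length_append, List.length_cons]
    omega

theorem length_iter (φ : ℕ → List ℕ) (c : ℕ) (t : List ℕ) (hc : φ c = c :: t) (ht : t ≠ [])
    (h0 : ∀ n, φ n ≠ []) (n : ℕ) : n < (iter φ c n).length := by
  induction n with
  | zero => simp [iter]
  | succ n ih =>
    obtain ⟨s, hs⟩ := iter_prefix φ c t hc (Nat.zero_le n)
    have h1 : iter φ c n = c :: s := by rw [← hs]; simp [iter]
    have h2 := length_le_flatMap φ h0 s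
    have h3 := List.length_pos_iff.mpr ht
    rw [iter_succ, h1, List.flatMap_cons, hc]
    rw [h1] at ih
    simp only [List.length_append, List.length_cons] at ih ⊢
    omega

theorem iterInf_eq (φ : ℕ → List ℕ) (c : ℕ) (t : List ℕ) (hc : φ c = c :: t) (ht : t ≠ [])
    (h0 : ∀ n, φ n ≠ []) (n i : ℕ) (hi : i < (iter φ c n).length) :
    iterInf φ c i = (iter φ c n)[i] := by
  have hl := length_iter φ c t hc ht h0 i
  have h1 : iterInf φ c i = (iter φ c i)[i] := by
    simp only [iterInf]
    exact List.getD_eq_getElem _ _ hl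
  rw [h1]
  rcases le_total i n with h | h
  · exact (iter_prefix φ c t hc h).getElem hl
  · exact ((iter_prefix φ c t hc h).getElem hi).symm

/-- The morphism `φ(n) = 0^{a-1} 1 0^{a-b-1} 1 0^{2a-2b-1} 1 0^{a-b-1} (n+1)`. All exponents are
non-negative as soon as `a > b`. -/
def phi (a b : ℕ) (n : ℕ) : List ℕ :=
  List.replicate (a - 1) 0 ++ [1] ++ List.replicate (a - b - 1) 0 ++ [1] ++
    List.replicate (2 * a - 2 * b - 1) 0 ++ [1] ++ List.replicate (a - b - 1) 0 ++ [n + 1]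

/-- The `k`-kernel `{s(kᵉ i + j)_{i ≥ 0} : e ≥ 0, 0 ≤ j ≤ kᵉ - 1}` of an integer sequence. -/
def kernel (k : ℕ) (s : ℕ → ℤ) : Set (ℕ → ℤ) :=
  {t | ∃ e j : ℕ, j < k ^ e ∧ t = fun i => s (k ^ e * i + j)}

/-- The sequence `s` is `k`-regular: the `ℤ`-module generated by its `k`-kernel is finitely
generated. (The notion is used for `k ≥ 2`.) -/
def IsRegular (k : ℕ) (s : ℕ → ℤ) : Prop :=
  (Submodule.span ℤ (kernel k s)).FG

/-- The equivalence relation `k ∼ l` (multiplicative dependence) on integers at least `2`. -/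
def MultDependent (k l : ℕ) : Prop :=
  ∃ s t : ℕ, 0 < s ∧ 0 < t ∧ k ^ s = l ^ t

/-- `ρ(a/b) = k`: the word `w_{a/b}` exists, and the integers `l ≥ 2` for which its sequence of
letters is `l`-regular are exactly the members of the class of `k` under `∼`. -/
def RhoEq (a b k : ℕ) : Prop :=
  2 ≤ k ∧ ∃ w : ℕ → ℕ, IsLexLeastPowerFree a b w ∧
    ∀ l : ℕ, 2 ≤ l → (IsRegular l (fun i => (w i : ℤ)) ↔ MultDependent k l)

end FracPow

/-! Put a = b + c and k = b + 5c = 5a - 4b; the bounds on a/b become b < 2c and 3c < 2b. An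
a/b-power is a window of cm letters equal to its translate by bm, for some m > 0. Indexed from 1,
the fixed point u satisfies u(kq) = u(q) + 1, and off the multiples of k it is 0 or 1 according to
the residue mod k.

Power-freeness (`exists_ne`) is a descent on m. If k ∣ m, the multiples of k in the window give a
power for m/k. Otherwise the k-periodic pattern of nonzero letters excludes the match: a window of
length at least k would force k ∣ bm, hence k ∣ m, and a shorter one has m ≤ 6, a finite check.
Minimality (`exists_eq_of_lt`) holds because lowering any letter completes a power.

Regularity (`isRegular_iff`) is a Cobham-type argument using only the scaling rule. An l-regular
sequence has a finite kernel mod 6; this forces the primes of l to divide k (`dvd_of_isRegular`) and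
the prime exponents of l and k to be proportional (`factorization_mul_le`). -/

namespace FracPow

/-! ### Scaling sequences, and regularity for bases multiplicatively dependent on k -/

/-- The sequence `u` on the positive integers increases by one under multiplication by `k`, and
off the multiples of `k` it depends on the residue mod `k` only, with values `0` and `1`. -/
structure IsScaling (k : ℕ) (u : ℕ → ℕ) : Prop where
  two_le : 2 ≤ k
  mul : ∀ q, 0 < q → u (k * q) = u q + 1
  residue : ∀ r, 0 < r → r < k → ∃ ε ≤ 1, ∀ q, u (k * q + r) = ε

namespace IsScaling

variable {k : ℕ} {u : ℕ → ℕ}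

theorem pow_mul (h : IsScaling k u) (v q : ℕ) (hq : 0 < q) : u (k ^ v * q) = u q + v := by
  have hk := h.two_le
  induction v with
  | zero => simp
  | succ v ih =>
    rw [pow_succ', mul_assoc, h.mul _ (by positivity), ih]
    omega

theorem le_one (h : IsScaling k u) {n : ℕ} (hn : ¬ k ∣ n) : u n ≤ 1 := by
  have hk := h.two_le
  obtain ⟨ε, hε, h1⟩ := h.residue (n % k)
    (Nat.pos_of_ne_zero fun h0 => hn (Nat.dvd_of_mod_eq_zero h0)) (Nat.mod_lt _ (by omega))
  rw [← Nat.div_add_mod n k, h1]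
  exact hε

/-- The value depends only on the base-k digits up to the last nonzero one, and adding a multiple of
k^(F+1) leaves those of z alone. -/
theorem add_pow_mul (h : IsScaling k u) (F z t : ℕ) (hz : 0 < z) (hF : z < k ^ F) :
    u (z + k ^ (F + 1) * t) = u z := by
  have hk := h.two_le
  induction F generalizing z with
  | zero => simp at hF; omega
  | succ F ih =>
    by_cases hd : k ∣ z
    · obtain ⟨y, rfl⟩ := hd
      have hy : 0 < y := Nat.pos_of_mul_pos_left hz
      have e1 : k * y + k ^ (F + 1 + 1) * t = k * (y + k ^ (F + 1) * t) := by ring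
      rw [e1, h.mul _ (by omega), h.mul _ hy, ih y hy]
      rw [pow_succ'] at hF
      exact lt_of_mul_lt_mul_left hF (Nat.zero_le _)
    · obtain ⟨ε, -, h1⟩ := h.residue (z % k)
        (Nat.pos_of_ne_zero fun h0 => hd (Nat.dvd_of_mod_eq_zero h0)) (Nat.mod_lt _ (by omega))
      have e1 : z + k ^ (F + 1 + 1) * t = k * (z / k + k ^ (F + 1) * t) + z % k := by
        conv_lhs => rw [← Nat.div_add_mod z k]
        ring
      rw [e1, h1]
      conv_rhs => rw [← Nat.div_add_mod z k]
      rw [h1]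

theorem pow_mul_bounds (h : IsScaling k u) {p : ℕ} (hp : p ∣ k) (v q : ℕ) (hq : ¬ p ∣ q) :
    v ≤ u (k ^ v * q) ∧ u (k ^ v * q) ≤ v + 1 := by
  have h0 : 0 < q := Nat.pos_of_ne_zero fun h0 => hq (h0 ▸ dvd_zero p)
  have := h.le_one (fun hk => hq (hp.trans hk))
  rw [h.pow_mul v q h0]
  omega

/-- Along an arithmetic progression with difference `k ^ e` the sequence is an affine function of
itself. -/
theorem affine (h : IsScaling k u) (e j : ℕ) (hj : j < k ^ e) :
    ∃ α β : ℤ, ∀ i, (u (k ^ e * i + j + 1) : ℤ) = α * u (i + 1) + β := by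
  have hk := h.two_le
  induction e generalizing j with
  | zero =>
    obtain rfl : j = 0 := by simpa using hj
    exact ⟨1, 0, fun i => by simp⟩
  | succ e ih =>
    have hlt : j % k < k := Nat.mod_lt _ (by omega)
    have hj' : j / k < k ^ e := by
      rw [Nat.div_lt_iff_lt_mul (by omega), ← pow_succ]; exact hj
    have e1 : ∀ i, k ^ (e + 1) * i + j + 1 = k * (k ^ e * i + j / k) + (j % k + 1) := by
      intro i
      conv_lhs => rw [← Nat.div_add_mod j k]
      ring
    -- Either the last digit fixes the value, so α = 0, or the argument is a multiple of k and one
    -- factor k comes off.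
    rcases Nat.lt_or_ge (j % k + 1) k with h1 | h1
    · obtain ⟨ε, -, h2⟩ := h.residue (j % k + 1) (by omega) h1
      exact ⟨0, ε, fun i => by rw [e1, h2]; simp⟩
    · obtain ⟨α, β, h2⟩ := ih _ hj'
      refine ⟨α, β + 1, fun i => ?_⟩
      have e2 : k * (k ^ e * i + j / k) + (j % k + 1) = k * (k ^ e * i + j / k + 1) := by
        have : j % k + 1 = k := by omega
        rw [this]; ring
      rw [e1, e2, h.mul _ (Nat.succ_pos _)]
      push_cast
      rw [h2]
      ring

theorem isRegular (h : IsScaling k u) {l : ℕ} (hl : 2 ≤ l) (hkl : MultDependent k l) :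
    IsRegular l (fun i => (u (i + 1) : ℤ)) := by
  obtain ⟨s, t, -, ht, hst⟩ := hkl
  let S : Set (ℕ → ℤ) := insert 1
    ((fun x : ℕ × ℕ => fun i => (u (l ^ x.1 * i + x.2 + 1) : ℤ)) '' (Set.Iio t ×ˢ Set.Iio (l ^ t)))
  have hS : S.Finite := (((Set.finite_Iio t).prod (Set.finite_Iio (l ^ t))).image _).insert 1
  have hN : IsNoetherian ℤ (Submodule.span ℤ S) := isNoetherian_span_of_finite ℤ hS
  refine Submodule.FG.of_le (Submodule.fg_span hS) (Submodule.span_le.2 ?_)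
  rintro _ ⟨e, j, hj, rfl⟩
  -- Split e as t(e/t) + e % t: the first part of l^e is a power of k, removed by `affine`, which
  -- leaves an exponent below t.
  have hL : k ^ (s * (e / t)) = l ^ (t * (e / t)) := by rw [_root_.pow_mul, hst, ← _root_.pow_mul]
  have hpos : 0 < l ^ (t * (e / t)) := by positivity
  obtain ⟨α, β, hab⟩ := h.affine (s * (e / t)) (j % l ^ (t * (e / t)))
    (by rw [hL]; exact Nat.mod_lt _ hpos)
  have hmod : e % t < t := Nat.mod_lt _ ht
  have hle : l ^ e = l ^ (t * (e / t)) * l ^ (e % t) := by rw [← pow_add, Nat.div_add_mod]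
  have hj1 : j / l ^ (t * (e / t)) < l ^ (e % t) := by
    rw [Nat.div_lt_iff_lt_mul hpos, mul_comm, ← hle]; exact hj
  have key : (fun i => (u (l ^ e * i + j + 1) : ℤ)) =
      α • (fun i => (u (l ^ (e % t) * i + j / l ^ (t * (e / t)) + 1) : ℤ)) + β • (1 : ℕ → ℤ) := by
    funext i
    have e1 : l ^ e * i + j = k ^ (s * (e / t)) * (l ^ (e % t) * i + j / l ^ (t * (e / t)))
        + j % l ^ (t * (e / t)) := by
      rw [hL, hle]
      conv_lhs => rw [← Nat.div_add_mod j (l ^ (t * (e / t)))]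
      ring
    rw [e1, hab]
    simp
  change (fun i => (u (l ^ e * i + j + 1) : ℤ)) ∈ Submodule.span ℤ S
  rw [key]
  refine add_mem (Submodule.smul_mem _ _ (Submodule.subset_span (Or.inr ?_)))
    (Submodule.smul_mem _ _ (Submodule.subset_span (Or.inl rfl)))
  exact ⟨(e % t, j / l ^ (t * (e / t))),
    ⟨hmod, hj1.trans_le (Nat.pow_le_pow_right (by omega) hmod.le)⟩, rfl⟩

end IsScaling

/-! ### Regularity forces multiplicative dependence -/

/-- Modulo `N > 0`, a regular sequence has a finite kernel. -/
theorem IsRegular.finite_kernel_mod {l : ℕ} {s : ℕ → ℤ} (h : IsRegular l s) (N : ℕ) [NeZero N] :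
    {g : ℕ → ZMod N | ∃ e j, j < l ^ e ∧ g = fun i => (s (l ^ e * i + j) : ZMod N)}.Finite := by
  obtain ⟨T, hT⟩ := h
  -- A kernel sequence mod N is determined by its coefficients mod N on finitely many generators.
  refine (Set.finite_range (fun c : T → ZMod N => fun i => ∑ x : T, c x * (x.1 i : ZMod N))).subset ?_
  rintro _ ⟨e, j, hj, rfl⟩
  have h1 : (fun i => s (l ^ e * i + j)) ∈ Submodule.span ℤ (T : Set (ℕ → ℤ)) := by
    rw [hT]; exact Submodule.subset_span ⟨e, j, hj, rfl⟩
  obtain ⟨f, hf⟩ := Submodule.mem_span_finset'.1 h1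
  refine ⟨fun x => (f x : ZMod N), funext fun i => ?_⟩
  have := congrFun hf i
  simp only [Finset.sum_apply, Pi.smul_apply, smul_eq_mul] at this
  rw [← this]
  push_cast
  rfl

theorem exists_add_mul_eq {h M d v : ℕ} (hM : 0 < M) (hh : 0 < h) (hc : Nat.Coprime h M) :
    ∃ i t, h * i + d = v + M * t := by
  obtain ⟨X, h1, h2⟩ := Nat.chineseRemainder hc d v
  -- Adding this multiple of hM makes the solution at least d and v, so that i and t are natural
  -- numbers.
  have h1' : X + h * M * (d + v) ≡ d [MOD h] := by
    refine Nat.ModEq.trans ?_ h1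
    simp [Nat.ModEq, mul_assoc]
  have h2' : X + h * M * (d + v) ≡ v [MOD M] := by
    refine Nat.ModEq.trans ?_ h2
    simp [Nat.ModEq, mul_comm h M, mul_assoc]
  have hle : d + v ≤ X + h * M * (d + v) :=
    le_add_left (Nat.le_mul_of_pos_left _ (by positivity))
  obtain ⟨i, hi⟩ := (Nat.modEq_iff_dvd' (by omega)).1 h1'.symm
  obtain ⟨t, ht⟩ := (Nat.modEq_iff_dvd' (by omega)).1 h2'.symm
  exact ⟨i, t, by omega⟩

namespace IsScaling

variable {k : ℕ} {u : ℕ → ℕ}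

/-- If p ∤ k, pigeonhole gives two progressions of step p^K, offset by δ, with equal values mod 6.
Since p^K is invertible modulo powers of k, the first can be steered to k-adic valuations differing
by 1, while the second keeps the value u(gδ). -/
theorem dvd_of_isRegular (h : IsScaling k u) {l p : ℕ} (hl : 2 ≤ l)
    (hr : IsRegular l (fun i => (u (i + 1) : ℤ))) (hp : p.Prime) (hpl : p ∣ l) : p ∣ k := by
  by_contra hpk
  have hk := h.two_le
  obtain ⟨g₀, rfl⟩ := hpl
  have hg₀ : 0 < g₀ := Nat.pos_of_ne_zero (by rintro rfl; simp at hl)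
  have hfin := hr.finite_kernel_mod 6
  set K := hfin.toFinset.card with hK
  have hKlt : K < p ^ K := Nat.lt_pow_self hp.one_lt
  set g := g₀ ^ K with hg
  set H := p ^ K with hH
  have hgpos : 0 < g := by positivity
  have hHpos : 0 < H := by omega
  have hlK : (p * g₀) ^ K = g * H := by rw [_root_.mul_pow, mul_comm]
  obtain ⟨d, hd, d', hd', hne, heq⟩ := Finset.exists_ne_map_eq_of_card_lt_of_maps_to
    (s := Finset.range H) (t := hfin.toFinset)
    (f := fun d => fun i => (((u (g * (H * i + (d + 1))) : ℕ) : ℤ) : ZMod 6))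
    (by rw [Finset.card_range]; exact hKlt) (by
      intro d hd
      have hd : d < H := by simpa using hd
      simp only [Set.Finite.coe_toFinset, Set.mem_ofPred_eq]
      refine ⟨K, g * (d + 1) - 1, ?_, ?_⟩
      · rw [hlK]
        have : g * (d + 1) ≤ g * H := Nat.mul_le_mul_left _ hd
        have : 0 < g * (d + 1) := by positivity
        omega
      · funext i
        have : (p * g₀) ^ K * i + (g * (d + 1) - 1) + 1 = g * (H * i + (d + 1)) := by
          have : 0 < g * (d + 1) := by positivity
          rw [hlK, add_assoc, Nat.sub_add_cancel this]
          ring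
        simp only [this])
  wlog hlt : d < d' generalizing d d'
  · exact this d' hd' d hd hne.symm heq.symm (by omega)
  obtain ⟨δ, hδ, rfl⟩ : ∃ δ, 0 < δ ∧ d' = d + δ := ⟨d' - d, by omega, by omega⟩
  -- F and G serve only to make k^F and k^G large enough for `add_pow_mul`.
  set F := g * δ with hF
  have hFlt : g * δ < k ^ F := Nat.lt_pow_self hk
  set G := g * k ^ (F + 2) with hG
  have hGlt : g * k ^ (F + 2) < k ^ G := Nat.lt_pow_self hk
  have hcop : Nat.Coprime H (k ^ (F + G + 3)) :=
    Nat.Coprime.pow _ _ ((Nat.Prime.coprime_iff_not_dvd hp).2 hpk)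
  -- both residues `k ^ (F + 1)` and `k ^ (F + 2)` are attained, and give different values
  have key : ∀ x, 1 ≤ x → x ≤ 2 → ((u g + (F + x) : ℕ) : ZMod 6) = ((u (g * δ) : ℕ) : ZMod 6) := by
    intro x hx1 hx2
    obtain ⟨i, t, hit⟩ := exists_add_mul_eq (d := d + 1) (v := k ^ (F + x))
      (by positivity : 0 < k ^ (F + G + 3)) hHpos hcop
    have h1 := congrFun heq i
    simp only [Int.cast_natCast] at h1
    have e1 : g * (H * i + (d + 1)) = g * k ^ (F + x) + k ^ (G + 1) * (k ^ (F + 2) * g * t) := by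
      rw [hit]; ring
    have e2 : g * (H * i + (d + δ + 1)) =
        g * δ + k ^ (F + 1) * (g * k ^ (x - 1) + k ^ (G + 2) * g * t) := by
      have : H * i + (d + δ + 1) = k ^ (F + x) + k ^ (F + G + 3) * t + δ := by omega
      obtain ⟨y, rfl⟩ : ∃ y, x = y + 1 := ⟨x - 1, by omega⟩
      rw [this, Nat.add_sub_cancel]; ring
    have hGx : g * k ^ (F + x) < k ^ G :=
      lt_of_le_of_lt (Nat.mul_le_mul_left _ (Nat.pow_le_pow_right (by omega) (by omega))) hGlt
    rw [e1, e2, h.add_pow_mul G _ _ (by positivity) hGx, h.add_pow_mul F _ _ (by positivity) hFlt,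
      mul_comm g, h.pow_mul _ _ hgpos] at h1
    exact h1
  have h1 := (key 1 le_rfl one_le_two).trans (key 2 one_le_two le_rfl).symm
  rw [ZMod.natCast_eq_natCast_iff] at h1
  unfold Nat.ModEq at h1
  omega

theorem exists_pow_mul_modEq {l : ℕ} (hl : 2 ≤ l)
    (hr : IsRegular l (fun i => (u (i + 1) : ℤ))) :
    ∃ e d, 0 < d ∧ ∀ i n, 0 < n → u (l ^ (e + i * d) * n) ≡ u (l ^ e * n) [MOD 6] := by
  have hfin := hr.finite_kernel_mod 6
  obtain ⟨e, e', hlt, heq⟩ := hfin.exists_lt_map_eq_of_forall_mem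
    (f := fun e : ℕ => fun i => (((u (l ^ e * (i + 1)) : ℕ) : ℤ) : ZMod 6)) (by
      intro e
      have hpos : 0 < l ^ e := by positivity
      refine ⟨e, l ^ e - 1, by omega, funext fun i => ?_⟩
      have : l ^ e * i + (l ^ e - 1) + 1 = l ^ e * (i + 1) := by
        rw [add_assoc, Nat.sub_add_cancel hpos]; ring
      simp only [this])
  have h1 : ∀ n, 0 < n → u (l ^ e * n) ≡ u (l ^ e' * n) [MOD 6] := by
    intro n hn
    have := congrFun heq (n - 1)
    simp only [Nat.sub_add_cancel hn, Int.cast_natCast] at this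
    rwa [ZMod.natCast_eq_natCast_iff] at this
  refine ⟨e, e' - e, by omega, fun i => ?_⟩
  induction i with
  | zero => intro n _; simp; rfl
  | succ i ih =>
    intro n hn
    have e1 : l ^ (e + (i + 1) * (e' - e)) * n = l ^ e' * (l ^ (i * (e' - e)) * n) := by
      rw [← mul_assoc, ← pow_add]
      congr 2
      rw [add_mul]
      omega
    have e2 : l ^ (e + i * (e' - e)) * n = l ^ e * (l ^ (i * (e' - e)) * n) := by
      rw [← mul_assoc, ← pow_add]
    have h2 := ih n hn
    rw [e2] at h2
    rw [e1]
    exact (h1 _ (by positivity)).symm.trans h2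

theorem pow_mul_pow_eq {p q r s a b x y α β N V W E F G : ℕ} (hp : a * N + x = α * V + E)
    (hq : b * N + y = β * V + F) (hr : W = V + G) :
    (p ^ a * q ^ b * s) ^ N * (p ^ x * q ^ y * r ^ W) =
      (p ^ α * q ^ β * r) ^ V * (p ^ E * q ^ F * r ^ G * s ^ N) := by
  have hp' : p ^ (a * N) * p ^ x = p ^ (α * V) * p ^ E := by rw [← pow_add, ← pow_add, hp]
  have hq' : q ^ (b * N) * q ^ y = q ^ (β * V) * q ^ F := by rw [← pow_add, ← pow_add, hq]
  rw [hr]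
  simp only [_root_.mul_pow, ← _root_.pow_mul, pow_add]
  calc _ = (p ^ (a * N) * p ^ x) * (q ^ (b * N) * q ^ y) * (r ^ V * r ^ G * s ^ N) := by
        ac_rfl
    _ = _ := by rw [hp', hq']; ring

/-- If p were relatively more frequent in l than q, some n would have the number of factors k in l^e
n limited by p, and in l^(e+id) n limited by q. These two counts can be shifted against each other
at will, against the periodicity mod 6. -/
theorem factorization_mul_le (h : IsScaling k u) {l p q : ℕ} (hl : 2 ≤ l)
    (hr : IsRegular l (fun i => (u (i + 1) : ℤ))) (hp : p.Prime) (hq : q.Prime)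
    (hpk : p ∣ k) (hqk : q ∣ k) :
    l.factorization p * k.factorization q ≤ l.factorization q * k.factorization p := by
  by_contra! hlt
  have hk := h.two_le
  have hpq : p ≠ q := by rintro rfl; exact lt_irrefl _ hlt
  obtain ⟨e, d, hd, hmod⟩ := exists_pow_mul_modEq hl hr
  have split : ∀ n, 0 < n → ∃ s, ¬ p ∣ s ∧ ¬ q ∣ s ∧
      n = p ^ n.factorization p * q ^ n.factorization q * s := by
    intro n hn
    obtain ⟨s, hs⟩ : p ^ n.factorization p * q ^ n.factorization q ∣ n :=
      Nat.Coprime.mul_dvd_of_dvd_of_dvd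
        (Nat.Coprime.pow _ _ ((Nat.coprime_primes hp hq).2 hpq))
        (Nat.ordProj_dvd n p) (Nat.ordProj_dvd n q)
    refine ⟨s, ?_, ?_, hs⟩
    · rintro ⟨s', rfl⟩
      refine Nat.pow_succ_factorization_not_dvd hn.ne' hp
        (Dvd.intro (q ^ n.factorization q * s') ?_)
      conv_rhs => rw [hs]
      ring
    · rintro ⟨s', rfl⟩
      refine Nat.pow_succ_factorization_not_dvd hn.ne' hq
        (Dvd.intro (p ^ n.factorization p * s') ?_)
      conv_rhs => rw [hs]
      ring
  obtain ⟨r, hpr, hqr, hkr⟩ := split k (by omega)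
  obtain ⟨s, hps, hqs, hls⟩ := split l (by omega)
  have hκ : 0 < k.factorization p := hp.factorization_pos_of_dvd (by omega) hpk
  have hκ' : 0 < k.factorization q := hq.factorization_pos_of_dvd (by omega) hqk
  generalize k.factorization p = κ at *
  generalize k.factorization q = κ' at *
  generalize l.factorization p = lam at *
  generalize l.factorization q = lam' at *
  have hr0 : 0 < r := Nat.pos_of_ne_zero fun h0 => hpr (h0 ▸ dvd_zero p)
  obtain ⟨E, hE⟩ : ∃ E, lam * κ' = lam' * κ + 1 + E := ⟨_, (Nat.add_sub_cancel' hlt).symm⟩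
  have hpq' : ¬ p ∣ q := fun hh => hpq ((Nat.prime_dvd_prime_iff_eq hp hq).1 hh)
  have hqp' : ¬ q ∣ p := fun hh => hpq ((Nat.prime_dvd_prime_iff_eq hq hp).1 hh).symm
  -- v is large enough that k^v contains the powers of p and q in l^e.
  obtain ⟨v, hv⟩ : ∃ v, v = e * (lam + lam') := ⟨_, rfl⟩
  obtain ⟨x, hx⟩ : ∃ x, v * κ = e * lam + x := by
    have h1 : e * lam ≤ v := hv ▸ Nat.mul_le_mul_left _ (by omega)
    have h2 : v ≤ v * κ := Nat.le_mul_of_pos_right _ (by omega)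
    exact ⟨_, (Nat.add_sub_cancel' (h1.trans h2)).symm⟩
  obtain ⟨y, hy⟩ : ∃ y, v * κ' = e * lam' + y := by
    have h1 : e * lam' ≤ v := hv ▸ Nat.mul_le_mul_left _ (by omega)
    have h2 : v ≤ v * κ' := Nat.le_mul_of_pos_right _ (by omega)
    exact ⟨_, (Nat.add_sub_cancel' (h1.trans h2)).symm⟩
  have main : ∀ c f, c + f = 3 → ∃ A B, u A ≡ u B [MOD 6] ∧
      (v + c + 3 * κ * d * lam' ≤ u A ∧ u A ≤ v + c + 3 * κ * d * lam' + 1) ∧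
      v ≤ u B ∧ u B ≤ v + 1 := by
    intro c f hcf
    -- The factor κ' makes the exponent of q an exact multiple of κ'; the factor 3κ makes the
    -- surplus of p at least 3κ ≥ cκ.
    refine ⟨_, _, hmod (3 * κ * κ')
      (p ^ x * q ^ (y + c * κ') * r ^ (v + c + 3 * κ * d * lam')) ?_, ?_, ?_⟩
    · have := hp.pos
      have := hq.pos
      positivity
    · have e1 : l ^ (e + 3 * κ * κ' * d) *
          (p ^ x * q ^ (y + c * κ') * r ^ (v + c + 3 * κ * d * lam')) =
          k ^ (v + c + 3 * κ * d * lam') *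
            (p ^ (κ * (3 * d * (1 + E) - 3) + κ * f) * s ^ (e + 3 * κ * κ' * d)) := by
        have hexp : lam * (e + 3 * κ * κ' * d) + x = κ * (v + c + 3 * κ * d * lam') +
            (κ * (3 * d * (1 + E) - 3) + κ * f) := by
          have h3 : 3 ≤ 3 * d * (1 + E) := by nlinarith
          obtain ⟨W, hW⟩ : ∃ W, 3 * d * (1 + E) = W + 3 := ⟨_, (Nat.sub_add_cancel h3).symm⟩
          rw [hW, Nat.add_sub_cancel]
          have hc' : f = 3 - c := by omega
          zify [(by omega : c ≤ 3)] at *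
          rw [hc']
          linear_combination 3 * κ * d * hE - hx + κ * hW
        have hexp' : lam' * (e + 3 * κ * κ' * d) + (y + c * κ') =
            κ' * (v + c + 3 * κ * d * lam') := by
          zify at *
          linear_combination -hy
        have := pow_mul_pow_eq (p := p) (q := q) (r := r) (s := s) (G := 0) (F := 0) hexp hexp'
          (add_zero _).symm
        rw [← hls, ← hkr] at this
        simpa using this
      rw [e1]
      refine h.pow_mul_bounds hqk _ _ ?_
      rw [hq.dvd_mul, not_or]
      exact ⟨fun hh => hqp' (hq.dvd_of_dvd_pow hh), fun hh => hqs (hq.dvd_of_dvd_pow hh)⟩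
    · have e1 : l ^ e * (p ^ x * q ^ (y + c * κ') * r ^ (v + c + 3 * κ * d * lam')) =
          k ^ v * (q ^ (c * κ') * r ^ (c + 3 * κ * d * lam') * s ^ e) := by
        have := pow_mul_pow_eq (p := p) (q := q) (r := r) (s := s) (N := e) (x := x)
          (y := y + c * κ') (a := lam) (b := lam') (α := κ) (β := κ') (V := v) (E := 0)
          (F := c * κ') (G := c + 3 * κ * d * lam') (by linarith) (by linarith)
          (add_assoc v c _)
        rw [← hls, ← hkr] at this
        simpa using this
      rw [e1]
      refine h.pow_mul_bounds hpk _ _ ?_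
      rw [hp.dvd_mul, hp.dvd_mul, not_or, not_or]
      exact ⟨⟨fun hh => hpq' (hp.dvd_of_dvd_pow hh), fun hh => hpr (hp.dvd_of_dvd_pow hh)⟩,
        fun hh => hps (hp.dvd_of_dvd_pow hh)⟩
  -- Up to an error of at most 1 the two values differ by c + 3κdλ', where λ' is `lam'`. So 3κdλ'
  -- lies in {-1, 0, 1} mod 6 for c = 0 and in {2, 3, 4} for c = 3; this is why the modulus is 6.
  obtain ⟨A, B, h1, h2, h3⟩ := main 0 3 rfl
  obtain ⟨A', B', h1', h2', h3'⟩ := main 3 0 rfl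
  unfold Nat.ModEq at h1 h1'
  omega

theorem isRegular_iff (h : IsScaling k u) {l : ℕ} (hl : 2 ≤ l) :
    IsRegular l (fun i => (u (i + 1) : ℤ)) ↔ MultDependent k l := by
  refine ⟨fun hr => ?_, h.isRegular hl⟩
  have hk := h.two_le
  obtain ⟨p, hp, hpl⟩ := Nat.exists_prime_and_dvd (by omega : l ≠ 1)
  have hpk := h.dvd_of_isRegular hl hr hp hpl
  refine ⟨l.factorization p, k.factorization p, hp.factorization_pos_of_dvd (by omega) hpl,
    hp.factorization_pos_of_dvd (by omega) hpk, ?_⟩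
  refine Nat.eq_of_factorization_eq (by positivity) (by positivity) fun q => ?_
  simp only [Nat.factorization_pow, Finsupp.smul_apply, smul_eq_mul]
  by_cases hq : q.Prime
  · by_cases hqk : q ∣ k
    · have h1 := h.factorization_mul_le hl hr hp hq hpk hqk
      have h2 := h.factorization_mul_le hl hr hq hp hqk hpk
      linarith
    · have hql : ¬ q ∣ l := fun hql => hqk (h.dvd_of_isRegular hl hr hq hql)
      rw [Nat.factorization_eq_zero_of_not_dvd hqk, Nat.factorization_eq_zero_of_not_dvd hql]
      simp
  · rw [Nat.factorization_eq_zero_of_not_prime _ hq, Nat.factorization_eq_zero_of_not_prime _ hq]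
    simp

end IsScaling

/-! ### The fixed word and the pattern of its nonzero letters -/

/-- The letters of the fixed point of `phi (b + c) b`, indexed from `1`. -/
structure IsFixedWord (b c : ℕ) (u : ℕ → ℕ) : Prop where
  mul : ∀ q, 0 < q → u ((b + 5 * c) * q) = u q + 1
  one : ∀ q r, r = b + c ∨ r = b + 2 * c ∨ r = b + 4 * c → u ((b + 5 * c) * q + r) = 1
  zero : ∀ q r, 0 < r → r < b + 5 * c → r ≠ b + c → r ≠ b + 2 * c → r ≠ b + 4 * c →
    u ((b + 5 * c) * q + r) = 0

/-- `n` is congruent modulo `b + 5 * c` to the position of a nonzero letter. -/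
def IsMark (b c n : ℕ) : Prop :=
  n % (b + 5 * c) = 0 ∨ n % (b + 5 * c) = b + c ∨ n % (b + 5 * c) = b + 2 * c ∨
    n % (b + 5 * c) = b + 4 * c

theorem mul_add_mod_eq {k j r : ℕ} (hr : r < k) : (k * j + r) % k = r := by
  rw [Nat.mul_add_mod, Nat.mod_eq_of_lt hr]

theorem isMark_of_eq {b c n : ℕ} (hc : 0 < c) (j : ℕ)
    (h : n = (b + 5 * c) * j ∨ n = (b + 5 * c) * j + (b + c) ∨ n = (b + 5 * c) * j + (b + 2 * c) ∨
      n = (b + 5 * c) * j + (b + 4 * c)) : IsMark b c n := by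
  unfold IsMark
  rcases h with rfl | rfl | rfl | rfl
  · left; simp
  · right; left; exact mul_add_mod_eq (by omega)
  · right; right; left; exact mul_add_mod_eq (by omega)
  · right; right; right; exact mul_add_mod_eq (by omega)

theorem not_isMark_of_lt {b c n : ℕ} (j : ℕ)
    (h1 : (b + 5 * c) * j < n) (h2 : n < (b + 5 * c) * j + (b + 5 * c))
    (h3 : n ≠ (b + 5 * c) * j + (b + c)) (h4 : n ≠ (b + 5 * c) * j + (b + 2 * c))
    (h5 : n ≠ (b + 5 * c) * j + (b + 4 * c)) : ¬ IsMark b c n := by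
  obtain ⟨r, rfl⟩ := Nat.exists_eq_add_of_lt h1
  rw [add_assoc] at *
  unfold IsMark
  rw [mul_add_mod_eq (by omega)]
  omega

namespace IsFixedWord

variable {b c : ℕ} {u : ℕ → ℕ}

theorem isScaling (h : IsFixedWord b c u) (hc : 0 < c) : IsScaling (b + 5 * c) u where
  two_le := by omega
  mul := h.mul
  residue r hr hrk := by
    by_cases hr' : r = b + c ∨ r = b + 2 * c ∨ r = b + 4 * c
    · exact ⟨1, le_rfl, fun q => h.one q r hr'⟩
    · exact ⟨0, zero_le_one, fun q => h.zero q r hr hrk (by omega) (by omega) (by omega)⟩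

theorem ne_zero_iff (h : IsFixedWord b c u) (hc : 0 < c) {n : ℕ} (hn : 0 < n) :
    u n ≠ 0 ↔ IsMark b c n := by
  have hlt : n % (b + 5 * c) < b + 5 * c := Nat.mod_lt _ (by omega)
  unfold IsMark
  by_cases h0 : n % (b + 5 * c) = 0
  · obtain ⟨q, rfl⟩ := Nat.dvd_of_mod_eq_zero h0
    simp [h.mul q (Nat.pos_of_mul_pos_left hn)]
  · by_cases h1 : n % (b + 5 * c) = b + c ∨ n % (b + 5 * c) = b + 2 * c ∨
      n % (b + 5 * c) = b + 4 * c
    · have := h.one (n / (b + 5 * c)) _ h1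
      rw [Nat.div_add_mod] at this
      simp [this, h1]
    · have := h.zero (n / (b + 5 * c)) _ (by omega) hlt (by omega) (by omega) (by omega)
      rw [Nat.div_add_mod] at this
      simp [this, h0, h1]

end IsFixedWord

section Marks

variable {b c : ℕ}

theorem isMark_mod (n q : ℕ) : IsMark b c ((b + 5 * c) * q + n) ↔ IsMark b c n := by
  simp [IsMark]

/-- A window of length `c * m < b + 5 * c` is not matched by its translate by `b * m`. -/
theorem not_isMark_iff_of_lt (h1 : b < 2 * c) (h2 : 3 * c < 2 * b) (h3 : 3 * b ≠ 5 * c)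
    {m r : ℕ} (hm : 0 < m) (hcm : c * m < b + 5 * c) (hr : r < b + 5 * c)
    (h : ∀ t < c * m, IsMark b c (r + t) ↔ IsMark b c (r + t + b * m)) : False := by
  have hc : 0 < c := by omega
  have hm6 : m ≤ 6 := by
    by_contra! h7
    have : c * 7 ≤ c * m := Nat.mul_le_mul_left _ h7
    omega
  have h' : ∀ x, r ≤ x → x < r + c * m → (IsMark b c x ↔ IsMark b c (x + b * m)) := by
    intro x hx1 hx2
    have := h (x - r) (by omega)
    rwa [Nat.add_sub_cancel' hx1] at this
  -- a mark in the window whose translate is not a mark, and conversely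
  have bad₁ : ∀ x y j j', y = x + b * m →
      (x = (b + 5 * c) * j ∨ x = (b + 5 * c) * j + (b + c) ∨ x = (b + 5 * c) * j + (b + 2 * c) ∨
        x = (b + 5 * c) * j + (b + 4 * c)) →
      (b + 5 * c) * j' < y → y < (b + 5 * c) * j' + (b + 5 * c) →
      y ≠ (b + 5 * c) * j' + (b + c) → y ≠ (b + 5 * c) * j' + (b + 2 * c) →
      y ≠ (b + 5 * c) * j' + (b + 4 * c) → ¬ (r ≤ x ∧ x < r + c * m) := by
    rintro x y j j' rfl hx a1 a2 a3 a4 a5 ⟨hr1, hr2⟩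
    exact not_isMark_of_lt j' a1 a2 a3 a4 a5 ((h' x hr1 hr2).1 (isMark_of_eq hc j hx))
  have bad₂ : ∀ x y j, y = x + b * m →
      (y = (b + 5 * c) * j ∨ y = (b + 5 * c) * j + (b + c) ∨ y = (b + 5 * c) * j + (b + 2 * c) ∨
        y = (b + 5 * c) * j + (b + 4 * c)) →
      0 < x → x < b + 5 * c → x ≠ b + c → x ≠ b + 2 * c → x ≠ b + 4 * c →
      ¬ (r ≤ x ∧ x < r + c * m) := by
    rintro x y j rfl hx a1 a2 a3 a4 a5 ⟨hr1, hr2⟩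
    exact not_isMark_of_lt 0 (by omega) (by omega) (by omega) (by omega) (by omega)
      ((h' x hr1 hr2).2 (isMark_of_eq hc j hx))
  clear h h'
  -- For each m the listed mismatches start at 0, reach at least k, and have successive gaps at most
  -- cm, so every window starting below k meets one.
  obtain rfl | rfl | rfl | rfl | rfl | rfl :
    m = 1 ∨ m = 2 ∨ m = 3 ∨ m = 4 ∨ m = 5 ∨ m = 6 := by omega
  · have := bad₁ 0 _ 0 0 rfl (by omega) (by omega) (by omega) (by omega) (by omega) (by omega)
    have := bad₂ c _ 0 rfl (by omega) (by omega) (by omega) (by omega) (by omega) (by omega)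
    have := bad₂ (2 * c) _ 0 rfl (by omega) (by omega) (by omega) (by omega) (by omega) (by omega)
    have := bad₁ (b + c) _ 0 0 rfl (by omega) (by omega) (by omega) (by omega) (by omega) (by omega)
    have := bad₁ (b + 2 * c) _ 0 0 rfl (by omega) (by omega) (by omega) (by omega) (by omega)
      (by omega)
    have := bad₂ (4 * c) _ 0 rfl (by omega) (by omega) (by omega) (by omega) (by omega) (by omega)
    have := bad₂ (5 * c) _ 1 rfl (by omega) (by omega) (by omega) (by omega) (by omega) (by omega)
    have := bad₁ (b + 4 * c) _ 0 1 rfl (by omega) (by omega) (by omega) (by omega) (by omega)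
      (by omega)
    have := bad₁ (b + 5 * c) _ 1 1 rfl (by omega) (by omega) (by omega) (by omega) (by omega)
      (by omega)
    omega
  · have := bad₁ 0 _ 0 0 rfl (by omega) (by omega) (by omega) (by omega) (by omega) (by omega)
    have := bad₂ (2 * c - b) _ 0 rfl (by omega) (by omega) (by omega) (by omega) (by omega)
      (by omega)
    have := bad₂ (4 * c - b) _ 0 rfl (by omega) (by omega) (by omega) (by omega) (by omega)
      (by omega)
    have := bad₁ (b + c) _ 0 0 rfl (by omega) (by omega) (by omega) (by omega) (by omega) (by omega)
    have := bad₁ (b + 2 * c) _ 0 1 rfl (by omega) (by omega) (by omega) (by omega) (by omega)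
      (by omega)
    have := bad₁ (b + 4 * c) _ 0 1 rfl (by omega) (by omega) (by omega) (by omega) (by omega)
      (by omega)
    have := bad₁ (b + 5 * c) _ 1 1 rfl (by omega) (by omega) (by omega) (by omega) (by omega)
      (by omega)
    omega
  · have := bad₁ 0 _ 0 0 rfl (by omega) (by omega) (by omega) (by omega) (by omega) (by omega)
    have := bad₁ (b + c) _ 0 1 rfl (by omega) (by omega) (by omega) (by omega) (by omega) (by omega)
    have := bad₁ (b + 4 * c) _ 0 1 rfl (by omega) (by omega) (by omega) (by omega) (by omega)
      (by omega)
    have := bad₁ (b + 5 * c) _ 1 1 rfl (by omega) (by omega) (by omega) (by omega) (by omega)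
      (by omega)
    omega
  · obtain hlt | hlt : 3 * b < 5 * c ∨ 5 * c < 3 * b := by omega
    · have := bad₁ 0 _ 0 0 rfl (by omega) (by omega) (by omega) (by omega) (by omega) (by omega)
      have := bad₁ (b + 2 * c) _ 0 1 rfl (by omega) (by omega) (by omega) (by omega) (by omega)
        (by omega)
      have := bad₁ (b + 5 * c) _ 1 1 rfl (by omega) (by omega) (by omega) (by omega) (by omega)
        (by omega)
      omega
    · have := bad₁ 0 _ 0 1 rfl (by omega) (by omega) (by omega) (by omega) (by omega) (by omega)
      have := bad₁ (b + 2 * c) _ 0 1 rfl (by omega) (by omega) (by omega) (by omega) (by omega)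
        (by omega)
      have := bad₁ (b + 5 * c) _ 1 2 rfl (by omega) (by omega) (by omega) (by omega) (by omega)
        (by omega)
      omega
  · have := bad₁ 0 _ 0 1 rfl (by omega) (by omega) (by omega) (by omega) (by omega) (by omega)
    have := bad₁ (b + c) _ 0 1 rfl (by omega) (by omega) (by omega) (by omega) (by omega) (by omega)
    have := bad₁ (b + 5 * c) _ 1 2 rfl (by omega) (by omega) (by omega) (by omega) (by omega)
      (by omega)
    omega
  -- In these two cases the translate of b + 2c, respectively b + c, is itself a mark, so b + 4c
  -- replaces them.
  · by_cases hb : 5 * b = 8 * c ∨ 5 * b = 9 * c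
    · have := bad₁ 0 _ 0 1 rfl (by omega) (by omega) (by omega) (by omega) (by omega) (by omega)
      have hz : ¬ (r ≤ b + 4 * c ∧ b + 4 * c < r + c * 6) := by
        rcases hb with hb | hb
        · exact bad₁ (b + 4 * c) _ 0 2 rfl (by omega) (by omega) (by omega) (by omega) (by omega)
            (by omega)
        · exact bad₁ (b + 4 * c) _ 0 2 rfl (by omega) (by omega) (by omega) (by omega) (by omega)
            (by omega)
      have := bad₁ (b + 5 * c) _ 1 2 rfl (by omega) (by omega) (by omega) (by omega) (by omega)
        (by omega)
      omega
    · have : ¬ (r ≤ b + c ∧ b + c < r + c * 6) := by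
        obtain hlt | hlt : 5 * b < 9 * c ∨ 9 * c < 5 * b := by omega
        · exact bad₁ (b + c) _ 0 1 rfl (by omega) (by omega) (by omega) (by omega) (by omega)
            (by omega)
        · exact bad₁ (b + c) _ 0 2 rfl (by omega) (by omega) (by omega) (by omega) (by omega)
            (by omega)
      have : ¬ (r ≤ b + 2 * c ∧ b + 2 * c < r + c * 6) := by
        obtain hlt | hlt : 5 * b < 8 * c ∨ 8 * c < 5 * b := by omega
        · exact bad₁ (b + 2 * c) _ 0 1 rfl (by omega) (by omega) (by omega) (by omega) (by omega)
            (by omega)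
        · exact bad₁ (b + 2 * c) _ 0 2 rfl (by omega) (by omega) (by omega) (by omega) (by omega)
            (by omega)
      have : ¬ (r ≤ 2 * b + 6 * c ∧ 2 * b + 6 * c < r + c * 6) := by
        obtain hlt | hlt : 5 * b < 9 * c ∨ 9 * c < 5 * b := by omega
        · exact bad₁ (2 * b + 6 * c) _ 1 2 rfl (by omega) (by omega) (by omega) (by omega) (by omega)
            (by omega)
        · exact bad₁ (2 * b + 6 * c) _ 1 3 rfl (by omega) (by omega) (by omega) (by omega) (by omega)
            (by omega)
      omega

end Marks

/-- The cyclic gaps between marks are b + c, c, 2c, c; the first is strictly the largest, so no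
nontrivial rotation preserves the pattern. -/
theorem mod_eq_zero_of_isMark_iff {b c s : ℕ} (h1 : b < 2 * c) (h2 : c < b)
    (h : ∀ n, IsMark b c n ↔ IsMark b c (n + s)) : s % (b + 5 * c) = 0 := by
  have hlt : s % (b + 5 * c) < b + 5 * c := Nat.mod_lt _ (by omega)
  have h' : ∀ n, IsMark b c n → IsMark b c (n + s % (b + 5 * c)) := by
    intro n hn
    have := (h n).1 hn
    unfold IsMark at this ⊢
    simpa using this
  have m0 := h' 0 (isMark_of_eq (by omega) 0 (by omega))
  rw [zero_add] at m0
  by_contra hs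
  rcases m0 with m0 | m0 | m0 | m0 <;> rw [Nat.mod_mod] at m0
  · exact hs m0
  · refine not_isMark_of_lt 1 ?_ ?_ ?_ ?_ ?_
      (h' (b + 4 * c) (isMark_of_eq (by omega) 0 (by omega))) <;> omega
  · refine not_isMark_of_lt 1 ?_ ?_ ?_ ?_ ?_
      (h' (b + 2 * c) (isMark_of_eq (by omega) 0 (by omega))) <;> omega
  · refine not_isMark_of_lt 1 ?_ ?_ ?_ ?_ ?_
      (h' (b + c) (isMark_of_eq (by omega) 0 (by omega))) <;> omega

theorem isMark_iff_of_window {b c s r L : ℕ} (hL : b + 5 * c ≤ L) (hc : 0 < c)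
    (h : ∀ t < L, IsMark b c (r + t) ↔ IsMark b c (r + t + s)) (n : ℕ) :
    IsMark b c n ↔ IsMark b c (n + s) := by
  have hk : 0 < b + 5 * c := by omega
  -- the representative of `n` in the window
  set t := (n + (b + 5 * c - 1) * r) % (b + 5 * c) with ht
  have htlt : t < b + 5 * c := Nat.mod_lt _ hk
  have hmod : r + t ≡ n [MOD b + 5 * c] := by
    have h1 : r + t ≡ r + (n + (b + 5 * c - 1) * r) [MOD b + 5 * c] :=
      Nat.ModEq.add_left _ (Nat.mod_modEq _ _)
    refine h1.trans ?_
    have : r + (n + (b + 5 * c - 1) * r) = n + (b + 5 * c) * r := by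
      obtain ⟨K, hK⟩ : ∃ K, b + 5 * c = K + 1 := ⟨b + 5 * c - 1, by omega⟩
      rw [hK, Nat.add_sub_cancel]; ring
    rw [this]
    simp [Nat.ModEq]
  have hmark : ∀ x y, x ≡ y [MOD b + 5 * c] → (IsMark b c x ↔ IsMark b c y) := by
    intro x y hxy
    unfold Nat.ModEq at hxy
    simp only [IsMark, hxy]
  rw [← hmark _ _ hmod, h t (by omega), hmark _ _ (hmod.add_right s)]

/-! ### Power-freeness and minimality of the fixed word -/

namespace IsFixedWord

variable {b c : ℕ} {u : ℕ → ℕ}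

theorem exists_ne (h : IsFixedWord b c u) (h1 : b < 2 * c) (h2 : 3 * c < 2 * b)
    (hbc : Nat.Coprime (b + 5 * c) b) (h3 : 3 * b ≠ 5 * c) (m : ℕ) :
    ∀ i, 0 < m → 0 < i → ∃ t < c * m, u (i + t) ≠ u (i + t + b * m) := by
  have hc : 0 < c := by omega
  induction m using Nat.strong_induction_on with
  | _ m ih =>
    intro i hm hi
    by_contra! hu
    have hmark : ∀ t < c * m, IsMark b c (i + t) ↔ IsMark b c (i + t + b * m) := by
      intro t ht
      rw [← h.ne_zero_iff hc (by omega), ← h.ne_zero_iff hc (by omega), hu t ht]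
    by_cases hk : (b + 5 * c) ∣ m
    · obtain ⟨m', rfl⟩ := hk
      have hm' : 0 < m' := Nat.pos_of_mul_pos_left hm
      -- kq is the first multiple of k at or after i.
      obtain ⟨q, hq⟩ : ∃ q, q = (i + (b + 5 * c) - 1) / (b + 5 * c) := ⟨_, rfl⟩
      have hq1 := Nat.div_add_mod (i + (b + 5 * c) - 1) (b + 5 * c)
      have hq2 : (i + (b + 5 * c) - 1) % (b + 5 * c) < b + 5 * c := Nat.mod_lt _ (by omega)
      rw [← hq] at hq1
      have hq0 : 0 < q := by
        rcases Nat.eq_zero_or_pos q with rfl | h0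
        · omega
        · exact h0
      obtain ⟨t, ht, hne⟩ := ih m' (by nlinarith) q hm' hq0
      refine hne ?_
      have hle : (b + 5 * c) * (t + 1) ≤ (b + 5 * c) * (c * m') := Nat.mul_le_mul_left _ ht
      have e0 : c * ((b + 5 * c) * m') = (b + 5 * c) * (c * m') := by ring
      have e1 : i + ((b + 5 * c) * (q + t) - i) = (b + 5 * c) * (q + t) :=
        Nat.add_sub_cancel' (by rw [mul_add]; omega)
      have h4 := hu ((b + 5 * c) * (q + t) - i) (by
        rw [e0]
        rw [mul_add] at hle ⊢
        omega)
      rw [e1] at h4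
      have e2 : (b + 5 * c) * (q + t) + b * ((b + 5 * c) * m') = (b + 5 * c) * (q + t + b * m') := by
        ring
      rw [e2, h.mul _ (by omega), h.mul _ (by omega)] at h4
      omega
    · rcases Nat.lt_or_ge (c * m) (b + 5 * c) with hlt | hge
      · refine not_isMark_iff_of_lt h1 h2 h3 hm hlt (Nat.mod_lt i (by omega)) fun t ht => ?_
        have := hmark t ht
        rw [← Nat.div_add_mod i (b + 5 * c), add_assoc, add_assoc, isMark_mod,
          isMark_mod] at this
        exact this
      · have := mod_eq_zero_of_isMark_iff h1 (by omega) (isMark_iff_of_window hge hc hmark)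
        exact hk (hbc.dvd_of_dvd_mul_left (Nat.dvd_of_mod_eq_zero this))

/-- Every letter of the word smaller than the actual one would complete a power. -/
theorem exists_eq_of_lt (h : IsFixedWord b c u) (h1 : b < 2 * c) (h2 : 3 * c < 2 * b) (n : ℕ) :
    ∀ x, 0 < n → x < u n → ∃ m, 0 < m ∧ (b + c) * m ≤ n ∧ u (n - b * m) = x ∧
      ∀ t, 0 < t → t < c * m → u (n - t) = u (n - t - b * m) := by
  have hc : 0 < c := by omega
  induction n using Nat.strong_induction_on with
  | _ n ih =>
    intro x hn hx
    have zero' : ∀ q r N, N = (b + 5 * c) * q + r → 0 < r → r < b + 5 * c → r ≠ b + c →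
        r ≠ b + 2 * c → r ≠ b + 4 * c → u N = 0 := by
      rintro q r N rfl
      exact h.zero q r
    obtain ⟨q, hq⟩ : ∃ q, q = n / (b + 5 * c) := ⟨_, rfl⟩
    have hqr := Nat.div_add_mod n (b + 5 * c)
    have hlt : n % (b + 5 * c) < b + 5 * c := Nat.mod_lt _ (by omega)
    rw [← hq] at hqr
    by_cases hr : n % (b + 5 * c) = 0
    · rw [hr, add_zero] at hqr
      subst hqr
      have hq0 : 0 < q := Nat.pos_of_mul_pos_left hn
      rw [h.mul q hq0] at hx
      -- Lowering to 0 takes m = 1: the c - 1 letters before a multiple of k, and their translates,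
      -- are 0. A positive letter comes from a power ending at q, dilated by k.
      rcases x with _ | x
      · obtain ⟨p, rfl⟩ : ∃ p, q = p + 1 := ⟨q - 1, by omega⟩
        have e := mul_add (b + 5 * c) p 1
        refine ⟨1, one_pos, by omega, zero' p (5 * c) _ ?_ ?_ ?_ ?_ ?_ ?_, fun t ht ht' => ?_⟩ <;>
          try omega
        rw [zero' p (b + 5 * c - t) _ ?_ ?_ ?_ ?_ ?_ ?_, zero' p (5 * c - t) _ ?_ ?_ ?_ ?_ ?_ ?_] <;>
          omega
      · obtain ⟨m, hm, hle, hx', heq⟩ := ih q (by nlinarith) x hq0 (by omega)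
        have e0 : b * ((b + 5 * c) * m) = (b + 5 * c) * (b * m) := by ring
        have e1 : c * ((b + 5 * c) * m) = (b + 5 * c) * (c * m) := by ring
        have hle' : b * m + c * m ≤ q := by linarith
        refine ⟨(b + 5 * c) * m, by positivity, ?_, ?_, ?_⟩
        · calc _ = (b + 5 * c) * ((b + c) * m) := by ring
            _ ≤ _ := Nat.mul_le_mul_left _ hle
        · have : 0 < c * m := by positivity
          rw [e0, ← Nat.mul_sub, h.mul _ (by omega), hx']
        · intro t ht ht'
          rw [e1] at ht'
          rw [e0]
          have hq1 : (b + 5 * c) * (b * m) + (b + 5 * c) * (c * m) ≤ (b + 5 * c) * q := by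
            rw [← mul_add]; exact Nat.mul_le_mul_left _ hle'
          obtain ⟨y, hy⟩ : ∃ y, y = t / (b + 5 * c) := ⟨_, rfl⟩
          have hty := Nat.div_add_mod t (b + 5 * c)
          have htr : t % (b + 5 * c) < b + 5 * c := Nat.mod_lt _ (by omega)
          rw [← hy] at hty
          have hyc : y < c * m := by
            rw [hy, Nat.div_lt_iff_lt_mul (by omega), mul_comm]; exact ht'
          by_cases ht0 : t % (b + 5 * c) = 0
          · rw [ht0, add_zero] at hty
            subst hty
            have hy0 : 0 < y := Nat.pos_of_mul_pos_left ht
            rw [← Nat.mul_sub, ← Nat.mul_sub, h.mul _ (by omega), h.mul _ (by omega),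
              heq y hy0 hyc]
          -- Off the multiples of k, both positions have the same residue mod k.
          · obtain ⟨ε, -, hε⟩ := (h.isScaling hc).residue (b + 5 * c - t % (b + 5 * c))
              (by omega) (by omega)
            have hd : (b + 5 * c) * (y + 1 + b * m) ≤ (b + 5 * c) * q :=
              Nat.mul_le_mul_left _ (by omega)
            have f1 : (b + 5 * c) * q - t =
                (b + 5 * c) * (q - (y + 1)) + (b + 5 * c - t % (b + 5 * c)) := by
              rw [Nat.mul_sub]
              rw [mul_add, mul_add] at hd
              rw [mul_add]
              omega
            have f2 : (b + 5 * c) * q - t - (b + 5 * c) * (b * m) =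
                (b + 5 * c) * (q - (y + 1 + b * m)) + (b + 5 * c - t % (b + 5 * c)) := by
              rw [Nat.mul_sub]
              rw [mul_add, mul_add] at hd ⊢
              omega
            rw [f2, f1, hε, hε]
    · have hcases : n % (b + 5 * c) = b + c ∨ n % (b + 5 * c) = b + 2 * c ∨
          n % (b + 5 * c) = b + 4 * c := by
        by_contra! hh
        have := zero' q _ n hqr.symm (by omega) hlt hh.1 hh.2.1 hh.2.2
        omega
      have hx0 : x = 0 := by
        have := h.one q _ hcases
        rw [hqr] at this
        omega
      subst hx0
      rcases hcases with hr | hr | hr <;> rw [hr] at hqr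
      · refine ⟨1, one_pos, by omega, zero' q c _ ?_ ?_ ?_ ?_ ?_ ?_, fun t ht ht' => ?_⟩ <;>
          try omega
        rw [zero' q (b + c - t) _ ?_ ?_ ?_ ?_ ?_ ?_, zero' q (c - t) _ ?_ ?_ ?_ ?_ ?_ ?_] <;> omega
      · refine ⟨1, one_pos, by omega, zero' q (2 * c) _ ?_ ?_ ?_ ?_ ?_ ?_, fun t ht ht' => ?_⟩ <;>
          try omega
        rw [zero' q (b + 2 * c - t) _ ?_ ?_ ?_ ?_ ?_ ?_,
          zero' q (2 * c - t) _ ?_ ?_ ?_ ?_ ?_ ?_] <;> omega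
      -- Here m = 1 fails, since the translated window meets the mark b + 2c; the gap 2c before b +
      -- 4c leaves room for m = 2.
      · refine ⟨2, two_pos, by omega, zero' q (4 * c - b) _ ?_ ?_ ?_ ?_ ?_ ?_,
          fun t ht ht' => ?_⟩ <;> try omega
        rw [zero' q (b + 4 * c - t) _ ?_ ?_ ?_ ?_ ?_ ?_,
          zero' q (4 * c - b - t) _ ?_ ?_ ?_ ?_ ?_ ?_] <;> omega

end IsFixedWord

/-! ### Powers as repetitions -/

theorem fracPow_eq {b c m : ℕ} (hc : c < b) (hb : 0 < b) {v : List ℕ} (hv : v.length = b * m) :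
    fracPow v (b + c) b = v ++ v.take (c * m) := by
  have e1 : (b + c) / b = 1 := by
    rw [Nat.add_div_left _ hb, Nat.div_eq_of_lt hc]
  have e2 : (b + c) % b = c := by
    rw [Nat.add_mod_left, Nat.mod_eq_of_lt hc]
  have e3 : b * m * c / b = c * m := by
    rw [mul_assoc, Nat.mul_div_cancel_left _ hb, mul_comm]
  rw [fracPow, e1, e2, hv, e3]
  simp

/-- As 1 < a/b < 2, a power is v followed by its prefix of length cm, where v has length bm. -/
theorem powerFree_iff {b c : ℕ} (hc : c < b) (x : ℕ → ℕ) :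
    PowerFree (b + c) b x ↔ ∀ i m, 0 < m → ∃ t < c * m, x (i + t) ≠ x (i + t + b * m) := by
  have hb : 0 < b := by omega
  constructor
  · intro h i m hm
    by_contra! hx
    refine h i (b * m + c * m) ⟨factor x i (b * m), ?_, ?_, ?_⟩
    · rw [← List.length_pos_iff]
      simp only [factor, List.length_map, List.length_range]
      positivity
    · simp [factor]
    · rw [fracPow_eq (m := m) hc hb (by simp [factor])]
      have hle : c * m ≤ b * m := Nat.mul_le_mul_right _ hc.le
      apply List.ext_getElem
      · simp [factor, hle]
      · intro n h1 h2
        have h1' : n < b * m + c * m := by simpa [factor] using h1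
        rcases Nat.lt_or_ge n (b * m) with hn | hn
        · rw [List.getElem_append_left (by simpa [factor] using hn)]
          simp [factor]
        · rw [List.getElem_append_right (by simpa [factor] using hn)]
          have := hx (n - b * m) (by omega)
          rw [show i + (n - b * m) + b * m = i + n by omega] at this
          simp [factor, this]
  · rintro h i n ⟨v, hv, ⟨m, hm⟩, hu⟩
    have hm0 : 0 < m := by
      have := List.length_pos_iff.2 hv
      rw [hm] at this
      exact Nat.pos_of_mul_pos_left this
    rw [fracPow_eq hc hb hm] at hu
    have hle : c * m ≤ b * m := Nat.mul_le_mul_right _ hc.le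
    have hlen : n = b * m + c * m := by
      have := congrArg List.length hu
      simpa [factor, hm, hle] using this
    obtain ⟨t, ht, hne⟩ := h i m hm0
    refine hne ?_
    have get : ∀ j (hj : j < n), x (i + j) = (factor x i n)[j]'(by simpa [factor] using hj) := by
      intro j hj
      simp [factor]
    rw [get t (by omega), add_assoc, get (t + b * m) (by omega)]
    simp only [hu]
    rw [List.getElem_append_left (by omega), List.getElem_append_right (by omega)]
    simp [hm]

/-- At the first difference from a smaller competitor, the competitor's letter would complete a
power in it. -/
theorem isLexLeast_of {b c : ℕ} (hc : c < b) {w : ℕ → ℕ} (hw : PowerFree (b + c) b w)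
    (h : ∀ n x, x < w n → ∃ m, 0 < m ∧ (b + c) * m ≤ n + 1 ∧ w (n - b * m) = x ∧
      ∀ t, 0 < t → t < c * m → w (n - t) = w (n - t - b * m)) :
    IsLexLeastPowerFree (b + c) b w := by
  refine ⟨hw, fun y hy => ?_⟩
  change PowerFree (b + c) b (ofLex y) at hy
  rw [powerFree_iff hc] at hy
  by_cases hne : ∃ n, w n ≠ ofLex y n
  · classical
    obtain ⟨n, hn, hmin⟩ : ∃ n, w n ≠ ofLex y n ∧ ∀ j < n, w j = ofLex y j :=
      ⟨Nat.find hne, Nat.find_spec hne, fun j hj => not_not.1 (Nat.find_min hne hj)⟩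
    refine le_of_lt ⟨n, hmin, ?_⟩
    change w n < ofLex y n
    refine lt_of_le_of_ne (not_lt.1 fun hlt => ?_) hn
    obtain ⟨m, hm, hle, hx, heq⟩ := h n _ hlt
    have hle' : b * m + c * m ≤ n + 1 := by linarith
    obtain ⟨t, ht, hne'⟩ := hy (n + 1 - (b * m + c * m)) m hm
    have hbm : 0 < b * m := Nat.mul_pos (by omega) hm
    refine hne' ?_
    -- The hypothesis counts backwards from n, the window forwards; t = cm - 1 is the differing
    -- letter itself.
    have e1 : n + 1 - (b * m + c * m) + t = n - (c * m - 1 - t) - b * m := by omega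
    have e2 : n + 1 - (b * m + c * m) + t + b * m = n - (c * m - 1 - t) := by omega
    rw [e2, e1, ← hmin (n - (c * m - 1 - t) - b * m) (by omega)]
    rcases Nat.eq_zero_or_pos (c * m - 1 - t) with h0 | h0
    · rw [h0, Nat.sub_zero, hx]
    · rw [← hmin (n - (c * m - 1 - t)) (by omega), heq _ h0 (by omega)]
  · push Not at hne
    exact le_of_eq (congrArg toLex (funext hne))

/-! ### The fixed point -/

theorem length_phi {b c : ℕ} (hc : 0 < c) (n : ℕ) : (phi (b + c) b n).length = b + 5 * c := by
  simp only [phi, List.length_append, List.length_replicate, List.length_cons, List.length_nil]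
  omega

theorem getD_phi {b c : ℕ} (hc : 0 < c) (n j : ℕ) (hj : j < b + 5 * c) :
    (phi (b + c) b n).getD j 0 = if j + 1 = b + c ∨ j + 1 = b + 2 * c ∨ j + 1 = b + 4 * c then 1
      else if j + 1 = b + 5 * c then n + 1 else 0 := by
  simp only [phi, List.getD_eq_getElem?_getD, List.getElem?_append, List.length_append,
    List.length_replicate, List.length_cons, List.length_nil, List.getElem?_replicate,
    List.getElem?_singleton]
  split_ifs <;> first | omega | rfl

theorem getD_flatMap {φ : ℕ → List ℕ} {k : ℕ} (hφ : IsUniform φ k) (L : List ℕ) (q j : ℕ)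
    (hq : q < L.length) (hj : j < k) :
    (L.flatMap φ).getD (k * q + j) 0 = (φ (L.getD q 0)).getD j 0 := by
  induction L generalizing q with
  | nil => simp at hq
  | cons a L ih =>
    have ha := hφ a
    rw [List.flatMap_cons]
    rcases q with _ | q
    · rw [List.getD_append _ _ _ _ (by rw [ha]; omega)]
      simp
    · have e : k * (q + 1) + j = k + (k * q + j) := by ring
      rw [List.getD_append_right _ _ _ _ (by rw [ha]; omega), ha, e, Nat.add_sub_cancel_left,
        ih q (by simpa using hq)]
      simp

theorem iterInf_mul_add {φ : ℕ → List ℕ} {k c : ℕ} {t : List ℕ} (hφ : IsUniform φ k) (hk : 2 ≤ k)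
    (hc : φ c = c :: t) (q j : ℕ) (hj : j < k) :
    iterInf φ c (k * q + j) = (φ (iterInf φ c q)).getD j 0 := by
  have h0 : ∀ n, φ n ≠ [] := fun n hn => by
    have := hφ n
    rw [hn] at this
    simp at this
    omega
  have ht : t ≠ [] := by
    rintro rfl
    have := hφ c
    rw [hc] at this
    simp at this
    omega
  have hq := length_iter φ c t hc ht h0 q
  have key : iterInf φ c (k * q + j) = (iter φ c (q + 1)).getD (k * q + j) 0 := by
    have hlt : k * q + j < (iter φ c (q + 1)).length := by
      have hlen : ∀ L : List ℕ, (L.flatMap φ).length = k * L.length := by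
        intro L
        induction L with
        | nil => simp
        | cons a L ih =>
          rw [List.flatMap_cons, List.length_append, ih, hφ a, List.length_cons]
          ring
      rw [iter_succ, hlen]
      calc k * q + j < k * (q + 1) := by rw [mul_add]; omega
        _ ≤ _ := Nat.mul_le_mul_left _ hq
    rw [iterInf_eq φ c t hc ht h0 _ _ hlt, List.getD_eq_getElem _ _ hlt]
  rw [key, iter_succ, getD_flatMap hφ _ _ _ hq hj]
  rfl

theorem isFixedWord_iterInf {b c : ℕ} (hb : 0 < b) (hc : 0 < c) :
    IsFixedWord b c (fun n => iterInf (phi (b + c) b) 0 (n - 1)) := by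
  have hU : IsUniform (phi (b + c) b) (b + 5 * c) := length_phi hc
  obtain ⟨t, ht⟩ : ∃ t, phi (b + c) b 0 = 0 :: t := by
    obtain ⟨A, hA⟩ : ∃ A, b + c - 1 = A + 1 := ⟨b + c - 2, by omega⟩
    rw [phi, hA, List.replicate_succ]
    exact ⟨_, rfl⟩
  have key : ∀ q r, 0 < r → r ≤ b + 5 * c → iterInf (phi (b + c) b) 0 ((b + 5 * c) * q + r - 1) =
      if r = b + c ∨ r = b + 2 * c ∨ r = b + 4 * c then 1
      else if r = b + 5 * c then iterInf (phi (b + c) b) 0 q + 1 else 0 := by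
    intro q r hr hr'
    obtain ⟨j, rfl⟩ : ∃ j, r = j + 1 := ⟨r - 1, by omega⟩
    rw [← add_assoc, Nat.add_sub_cancel, iterInf_mul_add hU (by omega) ht _ _ (by omega),
      getD_phi hc _ _ (by omega)]
  refine ⟨fun q hq => ?_, fun q r hr => ?_, fun q r h1 h2 h3 h4 h5 => ?_⟩
  · obtain ⟨p, rfl⟩ : ∃ p, q = p + 1 := ⟨q - 1, by omega⟩
    have := key p (b + 5 * c) (by omega) le_rfl
    rw [if_neg (by omega), if_pos rfl] at this
    simpa [mul_add] using this
  · rw [key q r (by omega) (by omega), if_pos hr]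
  · rw [key q r h1 h2.le, if_neg (by omega), if_neg (by omega)]

theorem isLexLeastPowerFree_iterInf {b c : ℕ} (h1 : b < 2 * c) (h2 : 3 * c < 2 * b)
    (hbc : Nat.Coprime (b + 5 * c) b) (h3 : 3 * b ≠ 5 * c) :
    IsLexLeastPowerFree (b + c) b (iterInf (phi (b + c) b) 0) := by
  have h := isFixedWord_iterInf (b := b) (c := c) (by omega) (by omega)
  refine isLexLeast_of (by omega) ((powerFree_iff (by omega) _).2 fun i m hm => ?_) fun n x hx => ?_
  · obtain ⟨t, ht, hne⟩ := h.exists_ne h1 h2 hbc h3 m (i + 1) hm (by omega)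
    refine ⟨t, ht, ?_⟩
    rwa [show i + 1 + t - 1 = i + t by omega, show i + 1 + t + b * m - 1 = i + t + b * m by omega]
      at hne
  · obtain ⟨m, hm, hle, hx', heq⟩ := h.exists_eq_of_lt h1 h2 (n + 1) x (by omega) hx
    refine ⟨m, hm, hle, ?_, fun t ht ht' => ?_⟩
    · rwa [show n + 1 - b * m - 1 = n - b * m by omega] at hx'
    · have := heq t ht ht'
      rwa [show n + 1 - t - 1 = n - t by omega,
        show n + 1 - t - b * m - 1 = n - t - b * m by omega] at this

end FracPow

theorem theorem4 (a b : ℕ) (ha : 0 < a) (hb : 0 < b) (hab : Nat.Coprime a b)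
    (hlow : (3 / 2 : ℚ) < (a : ℚ) / (b : ℚ)) (hupp : (a : ℚ) / (b : ℚ) < (5 / 3 : ℚ))
    (hb5 : Nat.gcd b 5 = 1) :
    FracPow.IsUniform (FracPow.phi a b) (5 * a - 4 * b) ∧
    FracPow.IsLexLeastPowerFree a b (FracPow.iterInf (FracPow.phi a b) 0) ∧
    FracPow.RhoEq a b (5 * a - 4 * b) := by
  have hbQ : (0 : ℚ) < b := by exact_mod_cast hb
  have hlow' : 3 * b < 2 * a := by
    rw [div_lt_div_iff₀ two_pos hbQ] at hlow
    have : (3 * b : ℚ) < 2 * a := by linarith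
    exact_mod_cast this
  have hupp' : 3 * a < 5 * b := by
    rw [div_lt_div_iff₀ hbQ three_pos] at hupp
    have : (3 * a : ℚ) < 5 * b := by linarith
    exact_mod_cast this
  obtain ⟨c, rfl⟩ : ∃ c, a = b + c := ⟨a - b, by omega⟩
  have hk : 5 * (b + c) - 4 * b = b + 5 * c := by omega
  have hcb : Nat.Coprime c b := by simpa using hab
  have hbc : Nat.Coprime (b + 5 * c) b := by
    have h5 : Nat.Coprime 5 b := Nat.Coprime.symm hb5
    simpa using h5.mul_left hcb
  -- At 3b = 5c one has 4b = k, and the check for m = 4 breaks down.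
  have h3 : 3 * b ≠ 5 * c := by
    intro h
    have : 5 ∣ b := (by norm_num : Nat.Coprime 5 3).dvd_of_dvd_mul_left (h ▸ dvd_mul_right 5 c)
    rw [Nat.gcd_eq_right this] at hb5
    omega
  have hlex := FracPow.isLexLeastPowerFree_iterInf (by omega) (by omega) hbc h3
  rw [hk]
  refine ⟨FracPow.length_phi (by omega), hlex, by omega, _, hlex, fun l hl => ?_⟩
  exact ((FracPow.isFixedWord_iterInf hb (by omega)).isScaling (by omega)).isRegular_iff hl
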